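/- Let $n\ge 2$ be an integer, let $a, z_1,\dots,z_{n-1}\in\mathbb{C}$ and put $p(z)=(z-a)\prod_{k=1}^{n-1}(z-z_k)$. Let $\zeta_1,\dots,\zeta_{n-1}$ be the critical points of $p$, listed with multiplicity, so that $p'(z)=n\prod_{j=1}^{n-1}(z-\zeta_j)$. Put $r_k=|z_k-a|$ and $\rho_j=|\zeta_j-a|$ for $1\le k,j\le n-1$. Then for every real $\rho>0$ and every real $m$, $$\prod_{\substack{1\le k\le n-1\\ r_k\ge\rho}}\frac{r_k}{\rho}\;\le\;\prod_{\substack{1\le j\le n-1\\ \rho_j\ge\rho^m}}\frac{\rho_j}{\rho^m}\;\cdot\prod_{\substack{1\le k\le n-1\\ 2\rho^{m-1}\sin(\pi k/n)\ge 1}}2\rho^{m-1}\sin\frac{\pi k}{n},$$ where an empty product equals $1$. (In particular this holds when $0<a<1$ and all $z_k$ lie in the closed unit disk, the setting of the Sendov conjecture.) -/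

import Mathlib

open Polynomial

/-! Translate `a` to `0`, so that `p` becomes `X * ∏ (X - (z k - a))`. Integrating `p'` divides its
`k`-th coefficient by `k + 1`, and `n / (k + 1) = n.choose (k + 1) / (n - 1).choose k`. Hence `∏ (X
- (z k - a))` is the Schur–Szegő composition of `∏ (X - (ζ j - a))` with `((X + 1) ^ n - 1) / X`,
whose zeros `ω ^ k - 1` have modulus `2 sin (π k / n)`. Scaling these two zero sets by `ρ ^ (-m)`
and `ρ ^ (m - 1)` scales the zeros of the composition by `1 / ρ`. Each product in the claim is then
the Mahler measure of a monic polynomial, and the claim is the de Bruijn–Springer inequality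
`mahlerMeasure_schurSzego_le`.

That inequality has two ingredients. By Grace–Szegő (`eval_schurSzego_ne_zero`, from Laguerre's
theorem) it is an equality `1 = 1 * 1` when all zeros lie in the closed disk. By a maximum principle
(`exists_mahlerMeasure_add_le`), any zero `w` can be moved to the unit circle at the cost of a
factor `max 1 ‖w‖`, since the composition is affine in each zero. -/

/-! ### Maximum principle for the Mahler measure of a pencil. -/

open MeasureTheory in
theorem integrable_log_norm_eval_circleMap (P : ℂ[X]) :
    Integrable (fun θ ↦ Real.log ‖P.eval (circleMap 0 1 θ)‖)
      (volume.restrict (Set.Ioc 0 (2 * Real.pi))) :=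
  (intervalIntegrable_iff_integrableOn_Ioc_of_le Real.two_pi_pos.le).1
    P.intervalIntegrable_mahlerMeasure

open MeasureTheory in
theorem integral_log_norm_eval_circleMap (P : ℂ[X]) :
    ∫ θ in Set.Ioc 0 (2 * Real.pi), Real.log ‖P.eval (circleMap 0 1 θ)‖
      = 2 * Real.pi * P.logMahlerMeasure := by
  have h := Real.two_pi_pos
  rw [logMahlerMeasure_def, Real.circleAverage_def, intervalIntegral.integral_of_le h.le, smul_eq_mul,
    mul_inv_cancel_left₀ h.ne']

/-- Jensen's formula in degree one: the circle average of `log ‖b s + a‖` is `log (max ‖b‖ ‖a‖)`. -/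
theorem log_norm_le_logMahlerMeasure_linear {a : ℂ} (ha : a ≠ 0) (b : ℂ) :
    Real.log ‖a‖ ≤ (C b * X + C a).logMahlerMeasure := by
  rcases eq_or_ne b 0 with rfl | hb
  · simp
  · rw [logMahlerMeasure_eq_log_MahlerMeasure, mahlerMeasure_C_mul_X_add_C hb]
    exact Real.log_le_log (norm_pos_iff.2 ha) (le_max_right _ _)

theorem exists_norm_eval_circleMap_le (P : ℂ[X]) :
    ∃ K, ∀ θ, ‖P.eval (circleMap 0 1 θ)‖ ≤ K := by
  obtain ⟨K, hK⟩ := (isCompact_sphere (0 : ℂ) 1).exists_bound_of_continuousOn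
    P.continuous.continuousOn
  exact ⟨K, fun θ ↦ hK _ (circleMap_mem_sphere 0 zero_le_one θ)⟩

open MeasureTheory in
/-- Averaging over the circle the value at the centre is dominated by a value on the circle, also
after adding a weight of mean zero. -/
theorem exists_logMahlerMeasure_add_le {A : ℂ[X]} (hA : A ≠ 0) (B : ℂ[X]) {h : ℝ → ℝ} {H : ℝ} (hH0 : 0 ≤ H)
    (hm : Measurable h) (hH : ∀ φ, -H ≤ h φ)
    (hi : Integrable h (volume.restrict (Set.Ioc 0 (2 * Real.pi))))
    (h0 : ∫ φ in Set.Ioc 0 (2 * Real.pi), h φ = 0) :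
    ∃ φ, A.logMahlerMeasure + h φ ≤ (A + C (circleMap 0 1 φ) * B).logMahlerMeasure := by
  obtain ⟨K₁, hK₁⟩ := exists_norm_eval_circleMap_le A
  obtain ⟨K₂, hK₂⟩ := exists_norm_eval_circleMap_le B
  have h2 := Real.two_pi_pos
  set μ := volume.restrict (Set.Ioc 0 (2 * Real.pi)) with hμ
  have hμu : μ Set.univ = ENNReal.ofReal (2 * Real.pi) := by simp [hμ]
  have hμr : μ.real Set.univ = 2 * Real.pi := by rw [Measure.real, hμu, ENNReal.toReal_ofReal h2.le]
  have hμ0 : μ ≠ 0 := by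
    intro h
    rw [h] at hμr
    simp at hμr
  set Q : ℝ → ℂ[X] := fun φ ↦ A + C (circleMap 0 1 φ) * B with hQ
  set L : ℝ := K₁ + K₂ + H with hL
  have hlog (φ θ : ℝ) : Real.log ‖(Q φ).eval (circleMap 0 1 θ)‖ ≤ K₁ + K₂ := by
    refine (Real.log_le_self (norm_nonneg _)).trans ?_
    simp only [hQ, eval_add, eval_mul, eval_C]
    refine (norm_add_le _ _).trans (add_le_add (hK₁ θ) ?_)
    rw [norm_mul]
    simpa using hK₂ θ
  have hlogA (θ : ℝ) : Real.log ‖A.eval (circleMap 0 1 θ)‖ ≤ K₁ + K₂ :=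
    (Real.log_le_self (norm_nonneg _)).trans
      ((hK₁ θ).trans (le_add_of_nonneg_right ((norm_nonneg _).trans (hK₂ θ))))
  -- The constant `L` makes the integrand nonnegative, so Tonelli applies without joint
  -- integrability.
  set g : ℝ → ℝ → ENNReal := fun φ θ ↦
    ENNReal.ofReal (L + h φ - Real.log ‖(Q φ).eval (circleMap 0 1 θ)‖) with hg
  have hmeas : Measurable (Function.uncurry g) := by
    have : Measurable fun x : ℝ × ℝ ↦
        A.eval (circleMap 0 1 x.2) + circleMap 0 1 x.1 * B.eval (circleMap 0 1 x.2) := by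
      have h1 : Continuous (circleMap 0 1) := continuous_circleMap 0 1
      exact Continuous.measurable (by fun_prop)
    have : Measurable fun x : ℝ × ℝ ↦ Real.log ‖(Q x.1).eval (circleMap 0 1 x.2)‖ := by
      simp only [hQ, eval_add, eval_mul, eval_C]
      exact Real.measurable_log.comp this.norm
    exact ENNReal.measurable_ofReal.comp
      ((measurable_const.add (hm.comp measurable_fst)).sub this)
  have hinner (φ : ℝ) : ∫⁻ θ, g φ θ ∂μ
      = ENNReal.ofReal (2 * Real.pi * (L + h φ - (Q φ).logMahlerMeasure)) := by
    rw [← ofReal_integral_eq_lintegral_ofReal]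
    · rw [integral_sub (integrable_const _) (integrable_log_norm_eval_circleMap _),
        integral_log_norm_eval_circleMap, integral_const, hμr, smul_eq_mul, mul_sub]
    · exact (integrable_const _).sub (integrable_log_norm_eval_circleMap _)
    · exact Filter.Eventually.of_forall fun θ ↦ by
        have := hlog φ θ
        have := hH φ
        simp only [Pi.zero_apply]
        linarith
  have hA0 : ∀ᵐ θ ∂μ, A.eval (circleMap 0 1 θ) ≠ 0 := by
    refine ae_restrict_of_ae ?_
    have hc : {x | A.eval x = 0}.Countable := by
      refine Set.Countable.mono (fun x hx ↦ ?_) (A.roots.toFinset.countable_toSet)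
      simpa [hA] using hx
    simpa [ae_iff] using (hc.preimage_circleMap 0 one_ne_zero).measure_zero volume
  have hswap : ∫⁻ φ, ∫⁻ θ, g φ θ ∂μ ∂μ
      ≤ ENNReal.ofReal (2 * Real.pi * (2 * Real.pi * (L - A.logMahlerMeasure))) := by
    rw [lintegral_lintegral_swap hmeas.aemeasurable]
    calc ∫⁻ θ, ∫⁻ φ, g φ θ ∂μ ∂μ
        ≤ ∫⁻ θ, ENNReal.ofReal
            (2 * Real.pi * (L - Real.log ‖A.eval (circleMap 0 1 θ)‖)) ∂μ := by
          refine lintegral_mono_ae (hA0.mono fun θ hθ ↦ ?_)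
          -- For fixed `θ` this is linear in `circleMap 0 1 φ`, so the degree-one Jensen bound
          -- applies.
          have he (φ : ℝ) : (Q φ).eval (circleMap 0 1 θ)
              = (C (B.eval (circleMap 0 1 θ)) * X + C (A.eval (circleMap 0 1 θ))).eval
                  (circleMap 0 1 φ) := by
            simp [hQ]
            ring
          rw [hg]
          simp only [he]
          have hint := ((integrable_const (μ := μ) L).add hi)
          rw [← ofReal_integral_eq_lintegral_ofReal]
          · refine ENNReal.ofReal_le_ofReal ?_
            rw [integral_sub (by exact hint) (integrable_log_norm_eval_circleMap _),
              integral_log_norm_eval_circleMap, integral_add (integrable_const _) hi, h0,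
              integral_const, hμr, smul_eq_mul, add_zero, mul_sub]
            have := log_norm_le_logMahlerMeasure_linear hθ (B.eval (circleMap 0 1 θ))
            gcongr
          · exact hint.sub (integrable_log_norm_eval_circleMap _)
          · exact Filter.Eventually.of_forall fun φ ↦ by
              have h1 := hlog φ θ
              have h3 := hH φ
              rw [he] at h1
              simp only [Pi.zero_apply]
              linarith
      _ = _ := by
          rw [← ofReal_integral_eq_lintegral_ofReal]
          · rw [integral_const_mul, integral_sub (integrable_const _)
              (integrable_log_norm_eval_circleMap _), integral_log_norm_eval_circleMap,
              integral_const, hμr, smul_eq_mul, mul_sub (2 * Real.pi) L]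
          · exact ((integrable_const _).sub (integrable_log_norm_eval_circleMap _)).const_mul _
          · exact Filter.Eventually.of_forall fun θ ↦ by
              have := hlogA θ
              exact mul_nonneg h2.le (by linarith)
  have hAL : A.logMahlerMeasure ≤ L := by
    have := integral_mono (integrable_log_norm_eval_circleMap A) (integrable_const (μ := μ) (K₁ + K₂))
      hlogA
    rw [integral_log_norm_eval_circleMap, integral_const, hμr, smul_eq_mul] at this
    have := le_of_mul_le_mul_left this h2
    linarith
  obtain ⟨φ, hφ⟩ := exists_le_laverage hμ0
    (f := fun φ ↦ ∫⁻ θ, g φ θ ∂μ) hmeas.lintegral_prod_right'.aemeasurable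
  refine ⟨φ, ?_⟩
  rw [laverage_eq, hμu, hinner] at hφ
  have hle := hφ.trans (ENNReal.div_le_div_right hswap _)
  rw [← ENNReal.ofReal_div_of_pos h2, mul_div_cancel_left₀ _ h2.ne',
    ENNReal.ofReal_le_ofReal_iff (mul_nonneg h2.le (by linarith))] at hle
  have := le_of_mul_le_mul_left hle h2
  change _ ≤ (Q φ).logMahlerMeasure
  linarith

theorem mahlerMeasure_C_mul (c : ℂ) (P : ℂ[X]) :
    (C c * P).mahlerMeasure = ‖c‖ * P.mahlerMeasure := by
  rw [mahlerMeasure_mul, mahlerMeasure_const]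

/-- The maximum principle for the Mahler measure of a pencil, in the open unit disk. -/
theorem exists_mahlerMeasure_add_le_of_norm_lt_one (A B : ℂ[X]) {w : ℂ} (hw : ‖w‖ < 1) :
    ∃ u : ℂ, ‖u‖ = 1 ∧ (A + C w * B).mahlerMeasure ≤ (A + C u * B).mahlerMeasure := by
  -- Otherwise the pencil vanishes somewhere on the circle, where `logMahlerMeasure` has the default
  -- value `0` instead of `-∞`.
  by_cases hAB : ∃ u : ℂ, ‖u‖ = 1 ∧ A = C u * B
  · obtain ⟨u, hu, rfl⟩ := hAB
    refine ⟨u, hu, ?_⟩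
    rw [← add_mul, ← add_mul, ← C_add, ← C_add, mahlerMeasure_C_mul, mahlerMeasure_C_mul]
    refine mul_le_mul_of_nonneg_right ?_ (mahlerMeasure_nonneg _)
    calc ‖u + w‖ ≤ ‖u‖ + ‖w‖ := norm_add_le _ _
      _ ≤ 2 * ‖u‖ := by linarith
      _ = ‖u + u‖ := by rw [← two_mul, norm_mul]; simp
  rcases eq_or_ne (A + C w * B) 0 with h0 | h0
  · exact ⟨1, by simp, by rw [h0, mahlerMeasure_zero]; exact mahlerMeasure_nonneg _⟩
  set v : ℂ := (starRingEnd ℂ) w with hv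
  have hvn : ‖v‖ = ‖w‖ := Complex.norm_conj w
  have hcirc (φ : ℝ) : ‖circleMap 0 1 φ‖ = 1 := by simp
  have hlow (φ : ℝ) : 1 - ‖w‖ ≤ ‖(C v * X + C 1).eval (circleMap 0 1 φ)‖ := by
    have := norm_sub_norm_le (1 : ℂ) (-(v * circleMap 0 1 φ))
    rw [norm_neg, norm_mul, hcirc, hvn, norm_one, mul_one, sub_neg_eq_add, add_comm 1] at this
    simpa using this
  -- The weight has mean zero because `1 + v s` has no zero in the closed disk.
  have hM : (C v * X + C 1).logMahlerMeasure = 0 := by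
    rw [logMahlerMeasure_eq_log_MahlerMeasure]
    rcases eq_or_ne v 0 with hv0 | hv0
    · simp [hv0]
    · rw [mahlerMeasure_C_mul_X_add_C hv0, norm_one, hvn, max_eq_right hw.le, Real.log_one]
  obtain ⟨φ, hφ⟩ := exists_logMahlerMeasure_add_le h0 (C v * A + B)
    (h := fun φ ↦ Real.log ‖(C v * X + C 1).eval (circleMap 0 1 φ)‖)
    (H := -Real.log (1 - ‖w‖))
    (by
      have := Real.log_nonpos (x := 1 - ‖w‖) (by linarith) (by linarith [norm_nonneg w])
      linarith)
    (Real.measurable_log.comp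
      (((C v * X + C 1).continuous.comp (continuous_circleMap 0 1)).norm.measurable))
    (fun φ ↦ by
      rw [neg_neg]
      exact Real.log_le_log (by linarith) (hlow φ))
    (integrable_log_norm_eval_circleMap _)
    (by rw [integral_log_norm_eval_circleMap, hM, mul_zero])
  set s := circleMap 0 1 φ with hs
  have hsn : ‖s‖ = 1 := hcirc φ
  set d : ℂ := v * s + 1 with hd
  have hdn : 0 < ‖d‖ := by
    have := hlow φ
    simp only [eval_add, eval_mul, eval_C, eval_X] at this
    linarith
  have hd0 : d ≠ 0 := norm_pos_iff.1 hdn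
  have hnum : ‖w + s‖ = ‖d‖ := by
    have h1 : (starRingEnd ℂ) s * s = 1 := by
      rw [← Complex.normSq_eq_conj_mul_self, Complex.normSq_eq_norm_sq, hsn]
      simp
    have h2 : (starRingEnd ℂ) (w + s) * s = d := by
      rw [map_add, add_mul, h1]
    rw [← h2, norm_mul, hsn, mul_one, Complex.norm_conj]
  have hun : ‖(w + s) / d‖ = 1 := by rw [norm_div, hnum, div_self hdn.ne']
  -- The disk automorphism `s ↦ (w + s) / (1 + v s)` moves the centre to `w`; its denominator is
  -- cancelled by the weight.
  have hfac : A + C w * B + C s * (C v * A + B) = C d * (A + C ((w + s) / d) * B) := by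
    rw [mul_add (C d), ← mul_assoc (C d), ← C_mul, mul_div_cancel₀ _ hd0]
    simp only [hd, C_add, C_mul, C_1]
    ring
  have hne : A + C ((w + s) / d) * B ≠ 0 := by
    intro h
    refine hAB ⟨-((w + s) / d), by rw [norm_neg, hun], ?_⟩
    rw [C_neg, neg_mul]
    exact eq_neg_of_add_eq_zero_left h
  refine ⟨_, hun, ?_⟩
  rw [hfac, logMahlerMeasure_C_mul hd0 hne] at hφ
  have he : (C v * X + C 1).eval s = d := by simp [hd]
  simp only [he] at hφ
  rw [mahlerMeasure_def_of_ne_zero h0, mahlerMeasure_def_of_ne_zero hne]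
  exact Real.exp_le_exp.2 (le_of_add_le_add_left ((add_comm _ _).trans_le hφ))

/-- The maximum principle for the Mahler measure of a pencil. -/
theorem exists_mahlerMeasure_add_le (A B : ℂ[X]) (w : ℂ) :
    ∃ u : ℂ, ‖u‖ = 1 ∧
      (A + C w * B).mahlerMeasure ≤ max 1 ‖w‖ * (A + C u * B).mahlerMeasure := by
  rcases lt_trichotomy ‖w‖ 1 with h | h | h
  · obtain ⟨u, hu, hle⟩ := exists_mahlerMeasure_add_le_of_norm_lt_one A B h
    exact ⟨u, hu, by rwa [max_eq_left h.le, one_mul]⟩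
  · exact ⟨w, h, by rw [h, max_self, one_mul]⟩
  · have hw0 : w ≠ 0 := norm_pos_iff.1 (zero_lt_one.trans h)
    obtain ⟨u, hu, hle⟩ := exists_mahlerMeasure_add_le_of_norm_lt_one B A (w := w⁻¹)
      (by rw [norm_inv]; exact inv_lt_one_of_one_lt₀ h)
    have hu0 : u ≠ 0 := norm_pos_iff.1 (hu ▸ zero_lt_one)
    refine ⟨u⁻¹, by rw [norm_inv, hu, inv_one], ?_⟩
    have h1 : A + C w * B = C w * (B + C w⁻¹ * A) := by
      rw [mul_add, ← mul_assoc, ← C_mul, mul_inv_cancel₀ hw0, C_1, one_mul, add_comm]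
    have h2 : B + C u * A = C u * (A + C u⁻¹ * B) := by
      rw [mul_add, ← mul_assoc, ← C_mul, mul_inv_cancel₀ hu0, C_1, one_mul, add_comm]
    rw [h2, mahlerMeasure_C_mul, hu, one_mul] at hle
    rw [max_eq_right h.le, h1, mahlerMeasure_C_mul]
    gcongr

/-! ### Laguerre's theorem for the closed unit disk. -/

/-- Inversion about a point outside the closed unit disk maps the disk into a disk. -/
theorem norm_one_div_sub_sub_le {t r : ℂ} (ht : 1 < ‖t‖) (hr : ‖r‖ ≤ 1) :
    ‖1 / (t - r) - (starRingEnd ℂ) t / ((‖t‖ ^ 2 - 1 : ℝ) : ℂ)‖ ≤ 1 / (‖t‖ ^ 2 - 1) := by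
  have hR : 0 < ‖t‖ ^ 2 - 1 := by nlinarith
  have hRc : ((‖t‖ ^ 2 - 1 : ℝ) : ℂ) ≠ 0 := by exact_mod_cast hR.ne'
  have htr : t - r ≠ 0 := by
    intro h
    rw [sub_eq_zero.1 h] at ht
    linarith
  have hc : t * (starRingEnd ℂ) t = ((‖t‖ ^ 2 - 1 : ℝ) : ℂ) + 1 := by
    rw [Complex.mul_conj, Complex.normSq_eq_norm_sq]
    push_cast
    ring
  have key : 1 / (t - r) - (starRingEnd ℂ) t / ((‖t‖ ^ 2 - 1 : ℝ) : ℂ)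
      = ((starRingEnd ℂ) t * r - 1) / (t - r) / ((‖t‖ ^ 2 - 1 : ℝ) : ℂ) := by
    field_simp
    linear_combination -hc
  rw [key, norm_div, Complex.norm_real, Real.norm_of_nonneg hR.le]
  refine div_le_div_of_nonneg_right ?_ hR.le
  rw [norm_div, div_le_one (norm_pos_iff.2 htr)]
  refine abs_le_of_sq_le_sq' ?_ (norm_nonneg _) |>.2
  rw [← Complex.normSq_eq_norm_sq, ← Complex.normSq_eq_norm_sq]
  have h1 : Complex.normSq t > 1 := by rw [Complex.normSq_eq_norm_sq]; linarith
  have h2 : Complex.normSq r ≤ 1 := by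
    rw [Complex.normSq_eq_norm_sq]
    exact pow_le_one₀ (norm_nonneg _) hr
  simp only [Complex.normSq_apply, Complex.sub_re, Complex.sub_im, Complex.mul_re, Complex.mul_im,
    Complex.conj_re, Complex.conj_im, Complex.one_re, Complex.one_im] at *
  -- `‖t - r‖² - ‖conj t * r - 1‖² = (‖t‖² - 1) (1 - ‖r‖²)`.
  nlinarith [mul_nonneg (sub_nonneg.2 h1.le) (sub_nonneg.2 h2)]

/-- If the roots of `f` lie in the closed unit disk, `t` lies outside it and `σ` is the mean of
`1 / (t - r)` over the roots `r`, then the centre of mass `t - 1 / σ` lies in the disk. -/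
theorem norm_mul_sub_one_le_of_roots {f : ℂ[X]} {N : ℕ} (hN : N ≠ 0) (hf : f.natDegree = N)
    (hroots : ∀ r ∈ f.roots, ‖r‖ ≤ 1) {t : ℂ} (ht : 1 < ‖t‖) (hft : f.eval t ≠ 0) {σ : ℂ}
    (hσ : f.derivative.eval t = N * σ * f.eval t) : ‖t * σ - 1‖ ≤ ‖σ‖ := by
  have hR : 0 < ‖t‖ ^ 2 - 1 := by nlinarith
  have hN' : (0 : ℝ) < N := by exact_mod_cast Nat.pos_of_ne_zero hN
  have hcard : f.roots.card = N := by
    rw [← hf]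
    exact (splits_iff_card_roots.1 (IsAlgClosed.splits f))
  have hsum : N * σ = (f.roots.map fun z ↦ 1 / (t - z)).sum := by
    rw [← (IsAlgClosed.splits f).eval_derivative_div_eval_of_ne_zero hft, hσ,
      mul_div_cancel_right₀ _ hft]
  set c : ℂ := (starRingEnd ℂ) t / ((‖t‖ ^ 2 - 1 : ℝ) : ℂ) with hc
  -- A mean of points of a disk stays in the disk.
  have hle : ‖σ - c‖ ≤ 1 / (‖t‖ ^ 2 - 1) := by
    have h1 : (N : ℂ) * (σ - c) = (f.roots.map fun z ↦ 1 / (t - z) - c).sum := by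
      rw [Multiset.sum_map_sub, ← hsum, Multiset.map_const', Multiset.sum_replicate, hcard,
        nsmul_eq_mul, mul_sub]
    have h2 : ‖(N : ℂ) * (σ - c)‖ ≤ N * (1 / (‖t‖ ^ 2 - 1)) := by
      rw [h1]
      refine (norm_multiset_sum_le _).trans ?_
      rw [Multiset.map_map, ← hcard, ← nsmul_eq_mul, ← Multiset.card_map
        (norm ∘ fun z ↦ 1 / (t - z) - c)]
      refine Multiset.sum_le_card_nsmul _ _ fun x hx ↦ ?_
      obtain ⟨r, hr, rfl⟩ := Multiset.mem_map.1 hx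
      exact norm_one_div_sub_sub_le ht (hroots r hr)
    rw [norm_mul, Complex.norm_natCast] at h2
    exact le_of_mul_le_mul_left h2 hN'
  refine abs_le_of_sq_le_sq' ?_ (norm_nonneg _) |>.2
  have hsq : ‖(((‖t‖ ^ 2 - 1 : ℝ) : ℂ)) * (σ - c)‖ ^ 2 ≤ 1 := by
    rw [norm_mul, Complex.norm_real, Real.norm_of_nonneg hR.le]
    refine pow_le_one₀ (by positivity) ?_
    rwa [le_div_iff₀' hR] at hle
  have hRc : ((‖t‖ ^ 2 - 1 : ℝ) : ℂ) ≠ 0 := by exact_mod_cast hR.ne'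
  rw [mul_sub, hc, mul_div_cancel₀ _ hRc] at hsq
  rw [← Complex.normSq_eq_norm_sq, Complex.normSq_apply] at hsq ⊢
  rw [← Complex.normSq_eq_norm_sq, Complex.normSq_apply]
  have hT : ‖t‖ ^ 2 = t.re * t.re + t.im * t.im := by
    rw [← Complex.normSq_eq_norm_sq, Complex.normSq_apply]
  generalize ‖t‖ ^ 2 = T at *
  simp only [Complex.sub_re, Complex.sub_im, Complex.mul_re, Complex.mul_im, Complex.ofReal_re,
    Complex.ofReal_im, Complex.conj_re, Complex.conj_im, Complex.one_re, Complex.one_im] at *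
  refine le_of_mul_le_mul_left ?_ hR
  subst hT
  nlinarith

/-- The polar derivative of a polynomial of degree `N`, with pole `-z / w`, scaled so as to make
sense for `w = 0`. -/
noncomputable def polarDerivative (N : ℕ) (z w : ℂ) (f : ℂ[X]) : ℂ[X] :=
  C z * derivative f - C w * (C (N : ℂ) * f - X * derivative f)

theorem coeff_polarDerivative (N : ℕ) (z w : ℂ) (f : ℂ[X]) (k : ℕ) :
    (polarDerivative N z w f).coeff k
      = z * ((k + 1) * f.coeff (k + 1)) - w * ((N - k) * f.coeff k) := by
  have hX : (X * derivative f).coeff k = k * f.coeff k := by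
    cases k with
    | zero => simp
    | succ k => rw [coeff_X_mul, coeff_derivative]; push_cast; ring
  rw [polarDerivative, coeff_sub, coeff_C_mul, coeff_C_mul, coeff_sub, coeff_C_mul, hX,
    coeff_derivative]
  ring

/-- Laguerre's theorem: zeros. -/
theorem norm_le_one_of_polarDerivative_eval_eq_zero {f : ℂ[X]} {N : ℕ} (hN : N ≠ 0)
    (hf : f.natDegree = N) (hroots : ∀ r ∈ f.roots, ‖r‖ ≤ 1) {z w t : ℂ} (hz : 1 < ‖z‖)
    (hw : ‖w‖ ≤ 1) (h : (polarDerivative N z w f).eval t = 0) : ‖t‖ ≤ 1 := by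
  by_contra! ht
  have hf0 : f ≠ 0 := by
    rintro rfl
    simp at hf
    exact hN hf.symm
  have hft : f.eval t ≠ 0 := fun h0 ↦ ht.not_ge (hroots t (by simpa [hf0] using h0))
  have hN' : (N : ℂ) ≠ 0 := by exact_mod_cast hN
  set σ : ℂ := f.derivative.eval t / (N * f.eval t) with hσ
  have hσ' : f.derivative.eval t = N * σ * f.eval t := by
    rw [hσ]
    field_simp
  have key := norm_mul_sub_one_le_of_roots hN hf hroots ht hft hσ'
  simp only [polarDerivative, eval_sub, eval_mul, eval_C, eval_X] at h
  rw [hσ'] at h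
  have h2 : z * σ = -(w * (t * σ - 1)) := by
    have : (N * f.eval t) * (z * σ + w * (t * σ - 1)) = 0 := by linear_combination h
    exact eq_neg_of_add_eq_zero_left
      ((mul_eq_zero.1 this).resolve_left (mul_ne_zero hN' hft))
  have h3 : ‖z‖ * ‖σ‖ ≤ ‖σ‖ := by
    rw [← norm_mul, h2, norm_neg, norm_mul]
    calc ‖w‖ * ‖t * σ - 1‖ ≤ 1 * ‖σ‖ := by gcongr
      _ = ‖σ‖ := one_mul _
  rcases eq_or_ne σ 0 with h0 | h0
  · rw [h0] at key
    norm_num at key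
  · have := norm_pos_iff.2 h0
    nlinarith

/-- Laguerre's theorem: degree. -/
theorem natDegree_polarDerivative {f : ℂ[X]} {M : ℕ} (hf : f.natDegree = M + 1)
    (hroots : ∀ r ∈ f.roots, ‖r‖ ≤ 1) {z w : ℂ} (hz : 1 < ‖z‖) (hw : ‖w‖ ≤ 1) :
    (polarDerivative (M + 1) z w f).coeff M ≠ 0 ∧
      (polarDerivative (M + 1) z w f).natDegree = M := by
  have hs := IsAlgClosed.splits f
  have hcard : f.roots.card = M + 1 := hf ▸ splits_iff_card_roots.1 hs
  have hnext : f.coeff M = -(f.leadingCoeff * f.roots.sum) := by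
    have := hs.nextCoeff_eq_neg_sum_roots_mul_leadingCoeff
    rw [nextCoeff_of_natDegree_pos (by omega), hf] at this
    simpa using this
  have hl : f.coeff (M + 1) = f.leadingCoeff := by rw [leadingCoeff, hf]
  have hl0 : f.leadingCoeff ≠ 0 := by
    rw [Ne, leadingCoeff_eq_zero]
    rintro rfl
    simp at hf
  have hsum : ‖f.roots.sum‖ ≤ M + 1 := by
    refine (norm_multiset_sum_le _).trans ?_
    have := Multiset.sum_le_card_nsmul (f.roots.map norm) 1 (by
      intro x hx
      obtain ⟨r, hr, rfl⟩ := Multiset.mem_map.1 hx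
      exact hroots r hr)
    simpa [hcard] using this
  -- Up to the leading coefficient of `f` this is `(M + 1) z + w * f.roots.sum`, whose first term
  -- dominates.
  have hne : (polarDerivative (M + 1) z w f).coeff M ≠ 0 := by
    rw [coeff_polarDerivative, hl, hnext]
    intro h
    have h1 : f.leadingCoeff * (z * (M + 1) + w * f.roots.sum) = 0 := by
      rw [← h]
      push_cast
      ring
    have h2 := eq_neg_of_add_eq_zero_left ((mul_eq_zero.1 h1).resolve_left hl0)
    have h3 : ‖z‖ * (M + 1) ≤ 1 * (M + 1) := by
      calc ‖z‖ * ((M : ℝ) + 1) = ‖z * (M + 1)‖ := by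
            rw [norm_mul]
            norm_cast
        _ = ‖w‖ * ‖f.roots.sum‖ := by rw [h2, norm_neg, norm_mul]
        _ ≤ 1 * (M + 1) := by gcongr
    have := le_of_mul_le_mul_right h3 (by positivity)
    linarith
  refine ⟨hne, le_antisymm (natDegree_le_iff_coeff_eq_zero.2 fun k hk ↦ ?_)
    (le_natDegree_of_ne_zero hne)⟩
  rw [coeff_polarDerivative, coeff_eq_zero_of_natDegree_lt (n := k + 1) (by omega)]
  rcases eq_or_ne k (M + 1) with rfl | hk'
  · simp
  · rw [coeff_eq_zero_of_natDegree_lt (n := k) (by omega)]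
    simp

/-! ### Schur–Szegő composition and the Grace–Szegő theorem. -/

/-- The Schur–Szegő composition of two polynomials of degree at most `N`. -/
noncomputable def schurSzego (N : ℕ) (f g : ℂ[X]) : ℂ[X] :=
  ∑ k ∈ Finset.range (N + 1), C (f.coeff k * g.coeff k / (N.choose k : ℂ)) * X ^ k

theorem coeff_schurSzego {N k : ℕ} (hk : k ≤ N) (f g : ℂ[X]) :
    (schurSzego N f g).coeff k = f.coeff k * g.coeff k / (N.choose k : ℂ) := by
  simp [schurSzego, coeff_X_pow, hk]

theorem natDegree_schurSzego_le (N : ℕ) (f g : ℂ[X]) : (schurSzego N f g).natDegree ≤ N :=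
  natDegree_sum_le_of_forall_le _ _ fun _ hk ↦
    (natDegree_C_mul_X_pow_le _ _).trans (Nat.lt_succ_iff.1 (Finset.mem_range.1 hk))

theorem schurSzego_comm (N : ℕ) (f g : ℂ[X]) : schurSzego N f g = schurSzego N g f := by
  simp only [schurSzego, mul_comm (f.coeff _)]

theorem schurSzego_add_C_mul (N : ℕ) (f g₁ g₂ : ℂ[X]) (c : ℂ) :
    schurSzego N f (g₁ + C c * g₂) = schurSzego N f g₁ + C c * schurSzego N f g₂ := by
  simp only [schurSzego, Finset.mul_sum, ← Finset.sum_add_distrib]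
  refine Finset.sum_congr rfl fun k _ ↦ ?_
  rw [coeff_add, coeff_C_mul, ← mul_assoc, ← C_mul, ← add_mul, ← C_add]
  congr 2
  ring

theorem eval_schurSzego (N : ℕ) (f g : ℂ[X]) (z : ℂ) : (schurSzego N f g).eval z
    = ∑ k ∈ Finset.range (N + 1), f.coeff k * g.coeff k / (N.choose k : ℂ) * z ^ k := by
  simp [schurSzego, eval_finsetSum]

/-- Splitting off a linear factor on one side of the composition amounts to a polar derivative on
the other. -/
theorem eval_schurSzego_mul_X_sub_C {M : ℕ} (f : ℂ[X]) {g : ℂ[X]} (hg : g.natDegree ≤ M)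
    (z w : ℂ) : (M + 1) * (schurSzego (M + 1) f ((X - C w) * g)).eval z
      = (schurSzego M (polarDerivative (M + 1) z w f) g).eval z := by
  have hcoeff (k : ℕ) : ((X - C w) * g).coeff k = (X * g).coeff k - w * g.coeff k := by
    rw [sub_mul, coeff_sub, coeff_C_mul]
  have hsucc {k : ℕ} (hk : k ≤ M) :
      (M + 1 : ℂ) / ((M + 1).choose (k + 1) : ℂ) = (k + 1) / (M.choose k : ℂ) := by
    have h1 : ((M + 1).choose (k + 1) : ℂ) ≠ 0 := by
      exact_mod_cast (Nat.choose_pos (by omega)).ne'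
    have h2 : (M.choose k : ℂ) ≠ 0 := by exact_mod_cast (Nat.choose_pos hk).ne'
    rw [div_eq_div_iff h1 h2, mul_comm (k + 1 : ℂ)]
    exact_mod_cast Nat.add_one_mul_choose_eq M k
  have hsame {k : ℕ} (hk : k ≤ M) :
      (M + 1 : ℂ) / ((M + 1).choose k : ℂ) = (M + 1 - k) / (M.choose k : ℂ) := by
    have h1 : ((M + 1).choose k : ℂ) ≠ 0 := by
      exact_mod_cast (Nat.choose_pos (by omega)).ne'
    have h2 : (M.choose k : ℂ) ≠ 0 := by exact_mod_cast (Nat.choose_pos hk).ne'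
    have h3 := Nat.choose_mul_succ_eq M k
    rw [div_eq_div_iff h1 h2, mul_comm, mul_comm _ ((M + 1).choose k : ℂ)]
    have h4 : ((M + 1 - k : ℕ) : ℂ) = M + 1 - k := by
      rw [Nat.cast_sub (by omega)]
      push_cast
      rfl
    rw [← h4]
    exact_mod_cast h3
  have hterm (k : ℕ) : (M + 1 : ℂ) * (f.coeff k * ((X * g).coeff k - w * g.coeff k)
        / ((M + 1).choose k : ℂ) * z ^ k)
      = (M + 1 : ℂ) / ((M + 1).choose k : ℂ) * (f.coeff k * (X * g).coeff k * z ^ k)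
        - (M + 1 : ℂ) / ((M + 1).choose k : ℂ) * (f.coeff k * (w * g.coeff k) * z ^ k) := by
    ring
  rw [eval_schurSzego, eval_schurSzego, Finset.mul_sum]
  simp only [hcoeff, hterm, Finset.sum_sub_distrib]
  rw [Finset.sum_range_succ', Finset.sum_range_succ (fun k ↦ (M + 1 : ℂ) /
    ((M + 1).choose k : ℂ) * (f.coeff k * (w * g.coeff k) * z ^ k)) (M + 1),
    coeff_eq_zero_of_natDegree_lt (Nat.lt_succ_of_le hg)]
  simp only [coeff_X_mul, coeff_X_mul_zero, mul_zero, zero_mul, add_zero,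
    coeff_polarDerivative]
  rw [← Finset.sum_sub_distrib]
  refine Finset.sum_congr rfl fun k hk ↦ ?_
  have hk' : k ≤ M := Nat.lt_succ_iff.1 (Finset.mem_range.1 hk)
  have e1 := hsucc hk'
  have e2 := hsame hk'
  calc _ = (M + 1 : ℂ) / ((M + 1).choose (k + 1) : ℂ) * (f.coeff (k + 1) * g.coeff k * z ^ (k + 1))
        - (M + 1 : ℂ) / ((M + 1).choose k : ℂ) * (f.coeff k * (w * g.coeff k) * z ^ k) := by ring
    _ = _ := by
      rw [e1, e2]
      push_cast
      ring

/-- The Grace–Szegő theorem for the closed unit disk. -/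
theorem eval_schurSzego_ne_zero (N : ℕ) {f : ℂ[X]} (hf0 : f ≠ 0) (hf : f.natDegree = N)
    (hroots : ∀ r ∈ f.roots, ‖r‖ ≤ 1) {s : Multiset ℂ} (hs : s.card = N)
    (hs1 : ∀ w ∈ s, ‖w‖ ≤ 1) {z : ℂ} (hz : 1 < ‖z‖) :
    (schurSzego N f (s.map fun w ↦ X - C w).prod).eval z ≠ 0 := by
  induction N generalizing f s with
  | zero =>
    rw [Multiset.card_eq_zero.1 hs, eval_schurSzego]
    have : f.coeff 0 ≠ 0 := by
      rw [← hf]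
      exact leadingCoeff_ne_zero.2 hf0
    simpa using this
  | succ M ih =>
    obtain ⟨w, hw⟩ := Multiset.card_pos_iff_exists_mem.1 (hs.symm ▸ M.succ_pos : 0 < s.card)
    obtain ⟨s, rfl⟩ := Multiset.exists_cons_of_mem hw
    rw [Multiset.card_cons, Nat.add_right_cancel_iff] at hs
    rw [Multiset.map_cons, Multiset.prod_cons]
    have hw1 := hs1 w hw
    obtain ⟨hc, hd⟩ := natDegree_polarDerivative hf hroots hz hw1
    have h0 : polarDerivative (M + 1) z w f ≠ 0 := by
      intro h
      rw [h] at hc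
      simp at hc
    have := ih h0 hd (fun r hr ↦ norm_le_one_of_polarDerivative_eval_eq_zero M.succ_ne_zero hf
      hroots hz hw1 (by simpa [h0] using hr)) hs fun x hx ↦ hs1 x (Multiset.mem_cons_of_mem hx)
    rw [← eval_schurSzego_mul_X_sub_C f
      (by rw [natDegree_multiset_prod_X_sub_C_eq_card, hs])] at this
    exact right_ne_zero_of_mul this

/-! ### The de Bruijn–Springer inequality. -/

theorem coeff_card_prod_X_sub_C (s : Multiset ℂ) :
    (s.map fun w ↦ X - C w).prod.coeff s.card = 1 := by
  have := (monic_multiset_prod_of_monic s (fun w : ℂ ↦ X - C w)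
    fun w _ ↦ monic_X_sub_C w).coeff_natDegree
  rwa [natDegree_multiset_prod_X_sub_C_eq_card] at this

/-- The composition is monic, and by Grace–Szegő it has no zero outside the closed disk. -/
theorem mahlerMeasure_schurSzego_of_norm_le_one {N : ℕ} {s t : Multiset ℂ} (hs : s.card = N)
    (ht : t.card = N) (hs1 : ∀ w ∈ s, ‖w‖ ≤ 1) (ht1 : ∀ w ∈ t, ‖w‖ ≤ 1) :
    (schurSzego N (s.map fun w ↦ X - C w).prod (t.map fun w ↦ X - C w).prod).mahlerMeasure = 1 := by
  set f := (s.map fun w ↦ X - C w).prod with hf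
  set h := schurSzego N f (t.map fun w ↦ X - C w).prod with hh
  have hc : h.coeff N = 1 := by
    rw [hh, coeff_schurSzego le_rfl, hf]
    nth_rewrite 1 [← hs]
    rw [coeff_card_prod_X_sub_C, ← ht, coeff_card_prod_X_sub_C]
    simp
  have hd : h.natDegree = N := le_antisymm (natDegree_schurSzego_le _ _ _)
    (le_natDegree_of_ne_zero (by rw [hc]; exact one_ne_zero))
  have hl : h.leadingCoeff = 1 := by rw [leadingCoeff, hd, hc]
  have hroot : ∀ r ∈ h.roots, ‖r‖ ≤ 1 := by
    intro r hr
    by_contra! hr1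
    refine eval_schurSzego_ne_zero N (f := f) ?_ ?_ ?_ ht ht1 hr1 (isRoot_of_mem_roots hr)
    · exact (monic_multiset_prod_of_monic _ _ fun w _ ↦ monic_X_sub_C w).ne_zero
    · rw [hf, natDegree_multiset_prod_X_sub_C_eq_card, hs]
    · rwa [hf, roots_multiset_prod_X_sub_C]
  rw [mahlerMeasure_eq_leadingCoeff_mul_prod_roots, hl, norm_one, one_mul]
  refine Multiset.prod_eq_one fun x hx ↦ ?_
  obtain ⟨r, hr, rfl⟩ := Multiset.mem_map.1 hx
  exact max_eq_left (hroot r hr)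

/-- Zeros outside the closed unit disk may be moved to the unit circle at the expense of the Mahler
measure of the polynomial. -/
theorem mahlerMeasure_schurSzego_le_of_forall {N : ℕ} (f : ℂ[X]) {K : ℝ}
    (h : ∀ t : Multiset ℂ, t.card = N → (∀ w ∈ t, ‖w‖ ≤ 1) →
      (schurSzego N f (t.map fun w ↦ X - C w).prod).mahlerMeasure ≤ K)
    (t : Multiset ℂ) : ∀ t₁ : Multiset ℂ, (t₁ + t).card = N → (∀ w ∈ t₁, ‖w‖ ≤ 1) →
      (schurSzego N f ((t₁ + t).map fun w ↦ X - C w).prod).mahlerMeasure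
        ≤ (t.map fun w ↦ max 1 ‖w‖).prod * K := by
  induction t using Multiset.induction with
  | empty => simpa using h
  | cons w t ih =>
    intro t₁ hc h1
    set P := ((t₁ + t).map fun w ↦ X - C w).prod with hP
    -- As a function of the single zero `u` the composition is a pencil. The multiset `t₁` collects
    -- the zeros already moved.
    have hsplit (u : ℂ) : schurSzego N f (((t₁ + u ::ₘ t)).map fun w ↦ X - C w).prod
        = schurSzego N f (X * P) + C u * schurSzego N f (-P) := by
      rw [← schurSzego_add_C_mul, Multiset.add_cons, Multiset.map_cons, Multiset.prod_cons]
      congr 1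
      ring
    obtain ⟨u, hu, hle⟩ :=
      exists_mahlerMeasure_add_le (schurSzego N f (X * P)) (schurSzego N f (-P)) w
    rw [← hsplit, ← hsplit] at hle
    have hmove : t₁ + u ::ₘ t = u ::ₘ t₁ + t := by rw [Multiset.add_cons, Multiset.cons_add]
    have := ih (u ::ₘ t₁) (by simpa [add_assoc, add_comm, add_left_comm] using hc) (by
      intro x hx
      rcases Multiset.mem_cons.1 hx with rfl | hx
      · exact hu.le
      · exact h1 x hx)
    rw [← hmove] at this
    rw [Multiset.map_cons, Multiset.prod_cons, mul_assoc]
    exact hle.trans (mul_le_mul_of_nonneg_left this (by positivity))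

/-- The de Bruijn–Springer theorem: the Mahler measure is submultiplicative under Schur–Szegő
composition. -/
theorem mahlerMeasure_schurSzego_le {N : ℕ} {s t : Multiset ℂ} (hs : s.card = N)
    (ht : t.card = N) :
    (schurSzego N (s.map fun w ↦ X - C w).prod (t.map fun w ↦ X - C w).prod).mahlerMeasure
      ≤ (s.map fun w ↦ max 1 ‖w‖).prod * (t.map fun w ↦ max 1 ‖w‖).prod := by
  -- The zeros in `t` are moved first, against a factor with zeros in the disk; then those in `s`.
  have main : ∀ s' : Multiset ℂ, s'.card = N → (∀ w ∈ s', ‖w‖ ≤ 1) →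
      (schurSzego N (t.map fun w ↦ X - C w).prod (s'.map fun w ↦ X - C w).prod).mahlerMeasure
        ≤ (t.map fun w ↦ max 1 ‖w‖).prod := by
    intro s' hs' hs1
    have := mahlerMeasure_schurSzego_le_of_forall (N := N) (K := 1)
      (s'.map fun w ↦ X - C w).prod
      (fun t' ht' ht1 ↦ (mahlerMeasure_schurSzego_of_norm_le_one hs' ht' hs1 ht1).le) t 0
      (by simpa using ht) (by simp)
    rw [schurSzego_comm]
    simpa using this
  have := mahlerMeasure_schurSzego_le_of_forall _ main s 0 (by simpa using hs) (by simp)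
  rw [schurSzego_comm]
  simpa using this

/-! ### Zeros and critical points as a composition. -/

theorem prod_X_sub_C_mul_eq_scaleRoots {ι : Type*} (s : Finset ι) (x : ι → ℂ) (c : ℂ) :
    ∏ i ∈ s, (X - C (c * x i)) = (∏ i ∈ s, (X - C (x i))).scaleRoots c := by
  induction s using Finset.cons_induction with
  | empty => simp
  | cons i s hi ih =>
    rw [Finset.prod_cons, Finset.prod_cons, mul_scaleRoots_of_noZeroDivisors, ih,
      X_sub_C_scaleRoots, mul_comm (x i)]

theorem coeff_prod_X_sub_C_mul {ι : Type*} (s : Finset ι) (x : ι → ℂ) (c : ℂ) (k : ℕ) :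
    (∏ i ∈ s, (X - C (c * x i))).coeff k
      = (∏ i ∈ s, (X - C (x i))).coeff k * c ^ (s.card - k) := by
  rw [prod_X_sub_C_mul_eq_scaleRoots, coeff_scaleRoots, natDegree_finsetProd_X_sub_C_eq_card]

/-- The nonzero zeros of `(X + 1) ^ n - 1`. -/
theorem coeff_prod_X_sub_C_root_of_unity {n : ℕ} {ω : ℂ} (hω : IsPrimitiveRoot ω n) (hn : 0 < n)
    (k : ℕ) : (∏ i ∈ Finset.Icc 1 (n - 1), (X - C (ω ^ i - 1))).coeff k
      = (n.choose (k + 1) : ℂ) := by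
  have h1 : (X ^ n - 1 : ℂ[X]) = ∏ i ∈ Finset.range n, (X - C (ω ^ i)) := by
    simpa using X_pow_sub_C_eq_prod hω hn (one_pow n)
  have h2 : ((X + 1) ^ n - 1 : ℂ[X]) = ∏ i ∈ Finset.range n, (X - C (ω ^ i - 1)) := by
    have := congrArg (fun p : ℂ[X] ↦ p.comp (X + 1)) h1
    simp only [sub_comp, pow_comp, X_comp, one_comp, prod_comp, C_comp] at this
    rw [this]
    refine Finset.prod_congr rfl fun i _ ↦ ?_
    rw [C_sub, C_1]
    ring
  have h3 : Finset.range n = insert 0 (Finset.Icc 1 (n - 1)) := by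
    ext i
    simp only [Finset.mem_range, Finset.mem_insert, Finset.mem_Icc]
    omega
  rw [h3, Finset.prod_insert (by simp), pow_zero, sub_self, C_0, sub_zero] at h2
  rw [← coeff_X_mul, ← h2, coeff_sub, coeff_X_add_one_pow, coeff_one]
  simp

theorem norm_exp_pow_sub_one {n k : ℕ} (hn : 0 < n) (hk : k ≤ n) :
    ‖Complex.exp (2 * Real.pi * Complex.I / n) ^ k - 1‖ = 2 * Real.sin (Real.pi * k / n) := by
  rw [← Complex.exp_nat_mul]
  have h : (k : ℂ) * (2 * Real.pi * Complex.I / n)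
      = Complex.I * ((2 * (Real.pi * k / n) : ℝ) : ℂ) := by
    push_cast
    ring
  rw [h, Complex.norm_exp_I_mul_ofReal_sub_one, mul_div_cancel_left₀ _ two_ne_zero]
  refine Real.norm_of_nonneg (mul_nonneg zero_le_two (Real.sin_nonneg_of_nonneg_of_le_pi
    (by positivity) ?_))
  rw [div_le_iff₀ (by positivity)]
  gcongr

theorem prod_filter_le_eq_prod_max_one {ι : Type*} (s : Finset ι) (x : ι → ℝ) :
    ∏ i ∈ s with 1 ≤ x i, x i = ∏ i ∈ s, max 1 (x i) := by
  rw [Finset.prod_filter]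
  refine Finset.prod_congr rfl fun i _ ↦ ?_
  split_ifs with h
  · rw [max_eq_right h]
  · rw [max_eq_left (not_le.1 h).le]

/-- Both sides are the `k`-th coefficient of the derivative of `p.comp (X + C a)`. -/
theorem coeff_prod_critical_points {n : ℕ} {a : ℂ} {z ζ : Fin (n - 1) → ℂ} {p : ℂ[X]}
    (hp : p = (X - C a) * ∏ k, (X - C (z k)))
    (hζ : derivative p = C (n : ℂ) * ∏ j, (X - C (ζ j))) (k : ℕ) :
    (n : ℂ) * (∏ j, (X - C (ζ j - a))).coeff k
      = (k + 1) * (∏ j, (X - C (z j - a))).coeff k := by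
  have hshift (x : Fin (n - 1) → ℂ) : (∏ j, (X - C (x j))).comp (X + C a)
      = ∏ j, (X - C (x j - a)) := by
    rw [prod_comp]
    refine Finset.prod_congr rfl fun j _ ↦ ?_
    rw [sub_comp, X_comp, C_comp, C_sub]
    ring
  have h1 : p.comp (X + C a) = X * ∏ j, (X - C (z j - a)) := by
    rw [hp, mul_comp, hshift]
    simp
  have h2 : derivative (p.comp (X + C a)) = C (n : ℂ) * ∏ j, (X - C (ζ j - a)) := by
    rw [derivative_comp, hζ, mul_comp, hshift]
    simp
  rw [← coeff_C_mul, ← h2, h1, coeff_derivative, coeff_X_mul, mul_comm]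

theorem theorem3 (n : ℕ) (hn : 2 ≤ n) (a : ℂ) (z ζ : Fin (n - 1) → ℂ) (p : ℂ[X])
    (hp : p = (X - C a) * ∏ k, (X - C (z k)))
    (hζ : derivative p = C (n : ℂ) * ∏ j, (X - C (ζ j)))
    (ρ m : ℝ) (hρ : 0 < ρ) :
    (∏ k with ρ ≤ ‖z k - a‖, ‖z k - a‖ / ρ) ≤
      (∏ j with ρ ^ m ≤ ‖ζ j - a‖, ‖ζ j - a‖ / ρ ^ m) *
        ∏ k ∈ Finset.Icc (1 : ℕ) (n - 1) with
            1 ≤ ρ ^ (m - 1) * (2 * Real.sin (Real.pi * ((k : ℕ) : ℝ) / (n : ℝ))),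
          ρ ^ (m - 1) * (2 * Real.sin (Real.pi * ((k : ℕ) : ℝ) / (n : ℝ))) := by
  have hn0 : n ≠ 0 := by omega
  have hρm : 0 < ρ ^ m := Real.rpow_pos_of_pos hρ m
  set ω := Complex.exp (2 * Real.pi * Complex.I / n) with hω
  -- The scalings of the two zero sets; only their product `1 / ρ` affects the composition, so `m`
  -- is free.
  set α : ℂ := ((ρ ^ m : ℝ) : ℂ)⁻¹ with hα
  set β : ℂ := ((ρ ^ (m - 1) : ℝ) : ℂ) with hβ
  have hαβ : α * β = ((ρ : ℝ) : ℂ)⁻¹ := by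
    rw [hα, hβ, Real.rpow_sub_one hρ.ne', ← Complex.ofReal_inv, ← Complex.ofReal_mul,
      ← Complex.ofReal_inv]
    congr 1
    field_simp
  have hαn (x : ℂ) : ‖α * x‖ = ‖x‖ / ρ ^ m := by
    rw [norm_mul, hα, norm_inv, Complex.norm_real, Real.norm_of_nonneg hρm.le, inv_mul_eq_div]
  have hβn {k : ℕ} (hk : k ∈ Finset.Icc 1 (n - 1)) : ‖β * (ω ^ k - 1)‖
      = ρ ^ (m - 1) * (2 * Real.sin (Real.pi * ((k : ℕ) : ℝ) / (n : ℝ))) := by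
    rw [norm_mul, norm_exp_pow_sub_one (by omega) (by have := Finset.mem_Icc.1 hk; omega), hβ,
      Complex.norm_real, Real.norm_of_nonneg (Real.rpow_pos_of_pos hρ _).le]
  set q : ℂ[X] := ∏ j, (X - C (((ρ : ℝ) : ℂ)⁻¹ * (z j - a))) with hq
  set s : Multiset ℂ := Finset.univ.val.map fun j ↦ α * (ζ j - a) with hs
  set t : Multiset ℂ := (Finset.Icc 1 (n - 1)).val.map fun k ↦ β * (ω ^ k - 1) with ht
  have hsc : s.card = n - 1 := by simp [hs]
  have htc : t.card = n - 1 := by simp [ht]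
  have hqs : schurSzego (n - 1) (s.map fun w ↦ X - C w).prod (t.map fun w ↦ X - C w).prod = q := by
    rw [hs, ht, Multiset.map_map, Multiset.map_map]
    change schurSzego (n - 1) (∏ j, (X - C (α * (ζ j - a))))
      (∏ k ∈ Finset.Icc 1 (n - 1), (X - C (β * (ω ^ k - 1)))) = q
    ext k
    rcases le_or_gt k (n - 1) with hk | hk
    · have h1 := coeff_prod_critical_points hp hζ k
      have h2 := coeff_prod_X_sub_C_root_of_unity (Complex.isPrimitiveRoot_exp n hn0)
        (Nat.pos_of_ne_zero hn0) k
      have h3 : (n : ℂ) * ((n - 1).choose k : ℂ) = (n.choose (k + 1) : ℂ) * (k + 1) := by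
        have := Nat.add_one_mul_choose_eq (n - 1) k
        rw [Nat.sub_add_cancel (by omega)] at this
        exact_mod_cast this
      have h4 : ((n - 1).choose k : ℂ) ≠ 0 := by exact_mod_cast (Nat.choose_pos hk).ne'
      have h5 : (n : ℂ) ≠ 0 := by exact_mod_cast hn0
      rw [coeff_schurSzego hk, hq, coeff_prod_X_sub_C_mul, coeff_prod_X_sub_C_mul,
        coeff_prod_X_sub_C_mul, h2, ← hαβ, mul_pow, div_eq_iff h4]
      simp only [Finset.card_univ, Fintype.card_fin, Nat.card_Icc, Nat.add_sub_cancel]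
      refine mul_left_cancel₀ h5 ?_
      linear_combination (α ^ (n - 1 - k) * β ^ (n - 1 - k) * (n.choose (k + 1) : ℂ)) * h1
        - (α ^ (n - 1 - k) * β ^ (n - 1 - k) * (∏ j, (X - C (z j - a))).coeff k) * h3
    · rw [coeff_eq_zero_of_natDegree_lt ((natDegree_schurSzego_le _ _ _).trans_lt hk),
        coeff_eq_zero_of_natDegree_lt]
      rw [hq, natDegree_finsetProd_X_sub_C_eq_card]
      simpa using hk
  have main := mahlerMeasure_schurSzego_le hsc htc
  have hqM : q.mahlerMeasure = ∏ k, max 1 (‖z k - a‖ / ρ) := by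
    have h1 : q = ((Finset.univ.val.map fun j ↦ ((ρ : ℝ) : ℂ)⁻¹ * (z j - a)).map
        fun w ↦ X - C w).prod := by
      rw [hq, Multiset.map_map]
      rfl
    rw [h1, prod_mahlerMeasure_eq_mahlerMeasure_prod, Multiset.map_map, Multiset.map_map]
    change ∏ k, (X - C (((ρ : ℝ) : ℂ)⁻¹ * (z k - a))).mahlerMeasure = _
    refine Finset.prod_congr rfl fun k _ ↦ ?_
    rw [mahlerMeasure_X_sub_C, norm_mul, norm_inv, Complex.norm_real, Real.norm_of_nonneg hρ.le,
      inv_mul_eq_div]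
  have hsM : (s.map fun w ↦ max 1 ‖w‖).prod = ∏ j, max 1 (‖ζ j - a‖ / ρ ^ m) := by
    rw [hs, Multiset.map_map]
    exact Finset.prod_congr rfl fun j _ ↦ congrArg (max 1) (hαn _)
  have htM : (t.map fun w ↦ max 1 ‖w‖).prod = ∏ k ∈ Finset.Icc 1 (n - 1),
      max 1 (ρ ^ (m - 1) * (2 * Real.sin (Real.pi * ((k : ℕ) : ℝ) / (n : ℝ)))) := by
    rw [ht, Multiset.map_map]
    exact Finset.prod_congr rfl fun k hk ↦ congrArg (max 1) (hβn hk)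
  rw [hqs, hqM, hsM, htM] at main
  simp only [← prod_filter_le_eq_prod_max_one, one_le_div hρ, one_le_div hρm] at main
  exact main
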